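/- Let $d\ge 1$. For a finite non-empty alphabet $\Sigma$ and a configuration $x\in\Sigma^{\mathbb{Z}^d}$ let $\Gamma_x=\{v\in\mathbb{Z}^d : x(z)=x(z+v)\text{ for all } z\in\mathbb{Z}^d\}$ be its lattice of periods. A set $X\subseteq\Sigma^{\mathbb{Z}^d}$ is an effective subshift if there is a recursively enumerable set $\mathcal F$ of finite patterns (colorings of finite subsets of $\mathbb{Z}^d$ by $\Sigma$) such that $X$ is the set of all configurations in which no translate of a pattern of $\mathcal F$ appears. A set $S$ of rank $d$ sublattices (subgroups) of $\mathbb{Z}^d$ is co-recursively enumerable (co-r.e.) if the set of $d$-tuples $(v_1,\dots,v_d)\in(\mathbb{Z}^d)^d$ that are a basis of a member of $S$ has a recursively enumerable complement in $(\mathbb{Z}^d)^d$. Theorem. For every set $S$ of subgroups of $\mathbb{Z}^d$, the following are equivalent: (i) there are a finite non-empty alphabet $\Sigma$ and an effective subshift $X\subseteq\Sigma^{\mathbb{Z}^d}$ with $S=\{\Gamma_x : x\in X,\ \operatorname{rank}\Gamma_x=d\}$; (ii) every member of $S$ has rank $d$, and $S$ is co-r.e. -/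

import Mathlib

/-- The lattice `Γ_x` of all vectors of periodicity of a configuration `x` on `ℤ^d`:
the vectors `v` with `x z = x (z + v)` for every `z`. -/
def periodLattice {A : Type*} {d : ℕ} (x : (Fin d → ℤ) → A) : Submodule ℤ (Fin d → ℤ) :=
  AddSubgroup.toIntSubmodule
    { carrier := {v | ∀ z, x z = x (z + v)}
      zero_mem' := fun z => by rw [add_zero]
      add_mem' := fun {v w} hv hw z => by rw [← add_assoc, ← hw (z + v), ← hv z]
      neg_mem' := fun {v} hv z => by rw [hv (z + -v), neg_add_cancel_right] }

/-- The lattices `Γ_x` of rank `d`, for `x` ranging over a set `X` of configurations on `ℤ^d`. -/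
def fullRankPeriodLattices {A : Type*} {d : ℕ} (X : Set ((Fin d → ℤ) → A)) :
    Set (Submodule ℤ (Fin d → ℤ)) :=
  {Γ | Module.finrank ℤ Γ = d ∧ ∃ x ∈ X, periodLattice x = Γ}

/-- The list `l` of pairs (position, letter) describes the finite pattern `p`: it lists exactly
the positions of the support of `p`, each with the letter that `p` has there (in any order,
possibly with repetitions). A list that puts two letters at one position describes no pattern. -/
def IsCodeOfPattern {A : Type*} [Inhabited A] {d : ℕ} (l : List ((Fin d → ℤ) × A))
    (p : SymbolicDynamics.FullShift.Pattern A (Fin d → ℤ)) : Prop :=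
  ∀ v a, (v, a) ∈ l ↔ v ∈ p.support ∧ p.config v = a

/-- A set of finite patterns is recursively enumerable: the set of the finite lists that
describe its members is. -/
def IsREPatternSet {A : Type*} [Inhabited A] [Primcodable A] {d : ℕ}
    (F : Set (SymbolicDynamics.FullShift.Pattern A (Fin d → ℤ))) : Prop :=
  REPred fun l : List ((Fin d → ℤ) × A) => ∃ p ∈ F, IsCodeOfPattern l p

/-- `X` is an effective subshift: the set of all configurations in which no pattern of `F`
appears, for some recursively enumerable set `F` of finite patterns. -/
def IsEffectiveSubshift {A : Type*} [Inhabited A] [Primcodable A] {d : ℕ}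
    (X : Set ((Fin d → ℤ) → A)) : Prop :=
  ∃ F : Set (SymbolicDynamics.FullShift.Pattern A (Fin d → ℤ)),
    IsREPatternSet F ∧ X = SymbolicDynamics.FullShift.forbidden F

/-- `p` is co-recursively enumerable: its complement is recursively enumerable. -/
def CoREPred {α : Type*} [Primcodable α] (p : α → Prop) : Prop :=
  REPred fun a => ¬ p a

/-- A set `S` of rank `d` sublattices of `ℤ^d` is co-recursively enumerable, a lattice being given
by a basis: given `d` vectors `v 0, …, v (d - 1)` of `ℤ^d`, it is a co-r.e. problem whether they
are a basis of a member of `S`. -/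
def IsCoRELatticeSet {d : ℕ} (S : Set (Submodule ℤ (Fin d → ℤ))) : Prop :=
  CoREPred fun v : Fin d → (Fin d → ℤ) =>
    LinearIndependent ℤ v ∧ Submodule.span ℤ (Set.range v) ∈ S

/-!
Both directions reduce to closure properties of r.e. predicates, once periodic configurations are
coded by numbers.

A lattice of full rank contains `m ℤ^d` for some `m > 0`, so a configuration with full rank lattice
of periods is determined by its restriction to the box `[0, m)^d`, that is, by one number `w`
(`boxConfig`, `exists_eq_boxConfig`). Whether its lattice of periods is spanned by given vectors
`v`, whose span contains `m ℤ^d`, can be tested inside the box (`boxPeriodsSpannedBy_iff`), so it is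
a primitive recursive condition on `m`, `w`, `v`.

Let `X` be an effective subshift. Independent vectors `v` with `m ℤ^d ⊆ span v` fail to span a
lattice of periods of `X` if and only if each of the finitely many configurations `boxConfig k m w`
has other periods or contains a forbidden pattern, and this is an r.e. condition
(`isCoRELatticeSet_fullRankPeriodLattices`).

Conversely, let `S` be co-r.e. Forbid the patterns on boxes `[0, 8 * m)^d` that agree with some
`boxConfig k m w` whose lattice of periods is not in `S`. A configuration of the resulting subshift
with full rank lattice of periods agrees with some `boxConfig k m w` everywhere, so its lattice of
periods is in `S`. What remains is to realize each `L ∈ S`: one needs a configuration `x` with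
lattice of periods `L` that has no periods `m ℤ^d` on a box of side `8 * m` unless `m ℤ^d ⊆ L`,
over an alphabet that does not depend on `L` (`exists_locally_aperiodic_config`). In direction `i`
the lines of `ℤ^d` become cycles of length `a`, the order of the `i`-th unit vector modulo `L`. On
each cycle write a marker followed by the parities of the `2`-adic valuations of `1, …, a - 1`.
If this word has period `m` on an interval of length `8 * m`, then `a ∣ m`: a marker there is
repeated at distance `m`, and without markers the period contradicts the fact that among `4 * m`
consecutive positions there is an `n` for which the valuations of `n` and `n + m` have different parities
(`exists_even_padicValInt_ne`, `dvd_of_markedRulerWord_eq`). A last track, the indicator function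
of `L`, excludes periods outside `L`.
-/

/-! ### Primitive recursive predicates and functions -/

namespace PrimrecPred

variable {α β : Type*} [Primcodable α] [Primcodable β]

theorem forall_lt_comp {p : α → ℕ → Prop} (hp : PrimrecPred fun q : α × ℕ => p q.1 q.2)
    {f : α → ℕ} (hf : Primrec f) : PrimrecPred fun a => ∀ i < f a, p a i := by
  have h : PrimrecRel fun (i : ℕ) (a : α) => p a i := hp.comp (Primrec.snd.pair Primrec.fst)
  exact ((h.forall_mem_list.comp (Primrec.list_range.comp hf) Primrec.id)).of_eq (by simp)

theorem exists_lt_comp {p : α → ℕ → Prop} (hp : PrimrecPred fun q : α × ℕ => p q.1 q.2)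
    {f : α → ℕ} (hf : Primrec f) : PrimrecPred fun a => ∃ i < f a, p a i := by
  have h : PrimrecRel fun (i : ℕ) (a : α) => p a i := hp.comp (Primrec.snd.pair Primrec.fst)
  exact ((h.exists_mem_list.comp (Primrec.list_range.comp hf) Primrec.id)).of_eq (by simp)

theorem forall_mem_list_comp {p : α → β → Prop} (hp : PrimrecPred fun q : α × β => p q.1 q.2)
    {f : α → List β} (hf : Primrec f) : PrimrecPred fun a => ∀ b ∈ f a, p a b := by
  have h : PrimrecRel fun (b : β) (a : α) => p a b := hp.comp (Primrec.snd.pair Primrec.fst)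
  exact (h.forall_mem_list.comp hf Primrec.id)

theorem exists_mem_list_comp {p : α → β → Prop} (hp : PrimrecPred fun q : α × β => p q.1 q.2)
    {f : α → List β} (hf : Primrec f) : PrimrecPred fun a => ∃ b ∈ f a, p a b := by
  have h : PrimrecRel fun (b : β) (a : α) => p a b := hp.comp (Primrec.snd.pair Primrec.fst)
  exact (h.exists_mem_list.comp hf Primrec.id)

theorem forall_fin {n : ℕ} {p : Fin n → α → Prop} (hp : ∀ i, PrimrecPred (p i)) :
    PrimrecPred fun a => ∀ i, p i a := by
  induction n with
  | zero => exact (Primrec.eq.comp (Primrec.const 0) (Primrec.const 0)).of_eq (by simp)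
  | succ n ih =>
    exact ((hp 0).and (ih fun i => hp i.succ)).of_eq fun a =>
      (Fin.forall_fin_succ (P := fun i => p i a)).symm

theorem mem_list {f : α → β} {g : α → List β} (hf : Primrec f) (hg : Primrec g) :
    PrimrecPred fun a => f a ∈ g a :=
  (exists_mem_list_comp (p := fun a b => b = f a)
    (Primrec.eq.comp Primrec.snd (hf.comp Primrec.fst)) hg).of_eq (by simp)

theorem imp {p q : α → Prop} (hp : PrimrecPred p) (hq : PrimrecPred q) :
    PrimrecPred fun a => p a → q a :=
  (hp.not.or hq).of_eq fun _ => imp_iff_not_or.symm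

end PrimrecPred

namespace Primrec

variable {α : Type*} [Primcodable α]

theorem nat_pow_comp {f g : α → ℕ} (hf : Primrec f) (hg : Primrec g) :
    Primrec fun a => f a ^ g a :=
  (Primrec₂.unpaired'.1 Nat.Primrec.pow).comp hf hg

/-- The encoding of `ℤ` sends `n` to `2 * n` and `-(n + 1)` to `2 * n + 1`. -/
theorem int_ofNat : Primrec (fun n : ℕ => (n : ℤ)) :=
  Primrec.encode_iff.1 (Primrec.nat_mul.comp (Primrec.const 2) Primrec.id)

theorem int_negSucc : Primrec Int.negSucc :=
  Primrec.encode_iff.1 (Primrec.succ.comp (Primrec.nat_mul.comp (Primrec.const 2) Primrec.id))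

theorem int_toNat : Primrec Int.toNat := by
  have h : Primrec fun n : ℕ => if n % 2 = 0 then n / 2 else 0 :=
    Primrec.ite (Primrec.eq.comp (Primrec.nat_mod.comp Primrec.id (Primrec.const 2))
      (Primrec.const 0)) (Primrec.nat_div.comp Primrec.id (Primrec.const 2)) (Primrec.const 0)
  refine (h.comp (Primrec.encode (α := ℤ))).of_eq fun z => ?_
  cases z with
  | ofNat n =>
    have : Encodable.encode (Int.ofNat n) = 2 * n := rfl
    rw [this]; simp
  | negSucc n =>
    have : Encodable.encode (Int.negSucc n) = 2 * n + 1 := rfl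
    rw [this, if_neg (by omega)]; simp

theorem int_toNat_neg : Primrec fun z : ℤ => (-z).toNat := by
  have h : Primrec fun n : ℕ => if n % 2 = 0 then 0 else n / 2 + 1 :=
    Primrec.ite (Primrec.eq.comp (Primrec.nat_mod.comp Primrec.id (Primrec.const 2))
      (Primrec.const 0)) (Primrec.const 0)
      (Primrec.succ.comp (Primrec.nat_div.comp Primrec.id (Primrec.const 2)))
  refine (h.comp (Primrec.encode (α := ℤ))).of_eq fun z => ?_
  cases z with
  | ofNat n =>
    have : Encodable.encode (Int.ofNat n) = 2 * n := rfl
    rw [this]; simp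
  | negSucc n =>
    have : Encodable.encode (Int.negSucc n) = 2 * n + 1 := rfl
    rw [this, if_neg (by omega)]; simp; omega

theorem int_subNat {f g : α → ℕ} (hf : Primrec f) (hg : Primrec g) :
    Primrec fun a => (f a : ℤ) - g a := by
  refine (Primrec.ite (c := fun a => g a ≤ f a) (Primrec.nat_le.comp hg hf)
    (int_ofNat.comp (Primrec.nat_sub.comp hf hg))
    (int_negSucc.comp (Primrec.pred.comp (Primrec.nat_sub.comp hg hf)))).of_eq fun a => ?_
  split_ifs with h
  · omega
  · rw [Int.negSucc_eq, Nat.pred_eq_sub_one]; omega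

theorem int_add {f g : α → ℤ} (hf : Primrec f) (hg : Primrec g) :
    Primrec fun a => f a + g a := by
  refine (int_subNat
    (Primrec.nat_add.comp (int_toNat.comp hf) (int_toNat.comp hg))
    (Primrec.nat_add.comp (int_toNat_neg.comp hf) (int_toNat_neg.comp hg))).of_eq fun a => ?_
  push_cast
  omega

theorem int_neg {f : α → ℤ} (hf : Primrec f) : Primrec fun a => -f a := by
  refine (int_subNat (int_toNat_neg.comp hf) (int_toNat.comp hf)).of_eq fun a => ?_
  omega

theorem int_sub {f g : α → ℤ} (hf : Primrec f) (hg : Primrec g) :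
    Primrec fun a => f a - g a :=
  (int_add hf (int_neg hg)).of_eq fun _ => (sub_eq_add_neg _ _).symm

theorem int_mul {f g : α → ℤ} (hf : Primrec f) (hg : Primrec g) :
    Primrec fun a => f a * g a := by
  have pf := int_toNat.comp hf
  have nf := int_toNat_neg.comp hf
  have pg := int_toNat.comp hg
  have ng := int_toNat_neg.comp hg
  refine (int_subNat
    (Primrec.nat_add.comp (Primrec.nat_mul.comp pf pg) (Primrec.nat_mul.comp nf ng))
    (Primrec.nat_add.comp (Primrec.nat_mul.comp pf ng) (Primrec.nat_mul.comp nf pg))).of_eq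
    fun a => ?_
  have h₁ : f a = (f a).toNat - (-f a).toNat := by omega
  have h₂ : g a = (g a).toNat - (-g a).toNat := by omega
  conv_rhs => rw [h₁, h₂]
  push_cast
  ring

theorem int_toNat_emod {f : α → ℤ} {m : α → ℕ} (hf : Primrec f) (hm : Primrec m) :
    Primrec fun a => (f a % m a).toNat := by
  -- `p - n ≡ p + (m - 1) * n` modulo `m`; both sides also agree for `m = 0`.
  refine (Primrec.nat_mod.comp (Primrec.nat_add.comp (int_toNat.comp hf) (Primrec.nat_mul.comp
    (Primrec.pred.comp hm) (int_toNat_neg.comp hf))) hm).of_eq fun a => ?_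
  generalize f a = z
  generalize m a = m
  rcases m with _ | m
  · simp
  · have h : z % ((m + 1 : ℕ) : ℤ) = ((z.toNat + m * (-z).toNat : ℕ) : ℤ) % ((m + 1 : ℕ) : ℤ) := by
      refine Int.emod_eq_emod_iff_emod_sub_eq_zero.2 (Int.emod_eq_zero_of_dvd
        ⟨-((-z).toNat : ℤ), ?_⟩)
      obtain ⟨n, rfl | rfl⟩ := z.eq_nat_or_neg
      · simp
      · simp
        ring
    rw [h]
    simp only [Nat.pred_eq_sub_one, Nat.add_sub_cancel]
    norm_cast

theorem int_natCast_dvd {f : α → ℤ} {m : α → ℕ} (hf : Primrec f) (hm : Primrec m) :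
    PrimrecPred fun a => (m a : ℤ) ∣ f a := by
  -- The second conjunct only matters for `m = 0`, where `z % 0 = z`.
  refine ((Primrec.eq.comp (int_toNat_emod hf hm) (Primrec.const 0)).and
    (Primrec.eq.comp (int_toNat_emod (int_neg hf) hm) (Primrec.const 0))).of_eq fun a => ?_
  generalize f a = z
  generalize m a = m
  rcases Nat.eq_zero_or_pos m with rfl | hm
  · simp; omega
  · have hm' : (m : ℤ) ≠ 0 := by omega
    have h₁ := Int.emod_nonneg z hm'
    have h₂ := Int.emod_nonneg (-z) hm'
    constructor
    · rintro ⟨h, -⟩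
      exact Int.dvd_of_emod_eq_zero (by omega)
    · intro h
      rw [Int.emod_eq_zero_of_dvd h, Int.emod_eq_zero_of_dvd (dvd_neg.2 h)]
      exact ⟨rfl, rfl⟩

theorem fin_sum {M : Type*} [AddCommMonoid M] [Primcodable M]
    (hadd : ∀ {f g : α → M}, Primrec f → Primrec g → Primrec fun a => f a + g a) {n : ℕ}
    {f : Fin n → α → M} (hf : ∀ i, Primrec (f i)) : Primrec fun a => ∑ i, f i a := by
  induction n with
  | zero => simpa using Primrec.const 0
  | succ n ih =>
    simp only [Fin.sum_univ_succ]
    exact hadd (hf 0) (ih fun i => hf i.succ)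

theorem fin_apply {β : Type*} [Primcodable β] {n : ℕ} {f : α → Fin n → β} (hf : Primrec f)
    (i : Fin n) : Primrec fun a => f a i :=
  Primrec.fin_app.comp hf (Primrec.const i)

theorem fin_lambda {β : Type*} [Primcodable β] {n : ℕ} {f : α → Fin n → β}
    (hf : ∀ i, Primrec fun a => f a i) : Primrec f :=
  Primrec.fin_curry.2 (Primrec.fin_curry₁ (f := fun i a => f a i) |>.2 hf |>.swap)

end Primrec

/-! ### Recursively enumerable predicates -/

namespace REPred

variable {α β : Type*} [Primcodable α] [Primcodable β]

/-- The projection normal form: an r.e. predicate is the projection of a primitive recursive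
one. The witness bounds the running time of a program that semidecides the predicate. -/
theorem iff_exists_primrecPred {p : α → Prop} :
    REPred p ↔ ∃ q : α → ℕ → Prop, PrimrecPred (fun b : α × ℕ => q b.1 b.2) ∧
      ∀ a, p a ↔ ∃ n, q a n := by
  constructor
  · intro h
    obtain ⟨c, hc⟩ := Nat.Partrec.Code.exists_code.1 h
    refine ⟨fun a n => (Nat.Partrec.Code.evaln n c (Encodable.encode a)).isSome, ?_, fun a => ?_⟩
    · exact Primrec.eq.comp (Primrec.option_isSome.comp (Nat.Partrec.Code.primrec_evaln.comp
        ((Primrec.snd.pair (Primrec.const c)).pair (Primrec.encode.comp Primrec.fst))))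
        (Primrec.const true)
    · have hdom : p a ↔ (c.eval (Encodable.encode a)).Dom := by
        rw [hc]
        simp [Part.bind_some, Part.assert]
      rw [hdom, Part.dom_iff_mem]
      simp only [Nat.Partrec.Code.evaln_complete, Option.isSome_iff_exists, Option.mem_def]
      exact exists_comm
  · classical
    rintro ⟨q, hq, h⟩
    have : Partrec fun a => Nat.rfind fun n => Part.some (decide (q a n)) :=
      Partrec.rfind (Primrec.to_comp hq.decide).partrec
    refine this.dom_re.of_eq fun a => ?_
    rw [h a]
    refine Nat.rfind_dom.trans ?_
    simp

theorem of_primrecPred {p : α → Prop} (hp : PrimrecPred p) : REPred p :=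
  hp.computablePred.to_re

theorem comp {p : β → Prop} (hp : REPred p) {f : α → β} (hf : Primrec f) :
    REPred fun a => p (f a) := by
  obtain ⟨q, hq, h⟩ := iff_exists_primrecPred.1 hp
  exact iff_exists_primrecPred.2 ⟨fun a n => q (f a) n,
    hq.comp ((hf.comp Primrec.fst).pair Primrec.snd), fun a => h _⟩

theorem and {p q : α → Prop} (hp : REPred p) (hq : REPred q) : REPred fun a => p a ∧ q a := by
  obtain ⟨p', hp', h⟩ := iff_exists_primrecPred.1 hp
  obtain ⟨q', hq', h'⟩ := iff_exists_primrecPred.1 hq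
  refine iff_exists_primrecPred.2 ⟨fun a n => p' a n.unpair.1 ∧ q' a n.unpair.2, ?_, fun a => ?_⟩
  · have hu := Primrec.unpair.comp (Primrec.snd (α := α) (β := ℕ))
    exact (hp'.comp (Primrec.fst.pair (Primrec.fst.comp hu))).and
      (hq'.comp (Primrec.fst.pair (Primrec.snd.comp hu)))
  · rw [h, h']
    constructor
    · rintro ⟨⟨i, hi⟩, j, hj⟩
      exact ⟨Nat.pair i j, by simpa using ⟨hi, hj⟩⟩
    · rintro ⟨n, h₁, h₂⟩
      exact ⟨⟨_, h₁⟩, _, h₂⟩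

theorem or {p q : α → Prop} (hp : REPred p) (hq : REPred q) : REPred fun a => p a ∨ q a := by
  obtain ⟨p', hp', h⟩ := iff_exists_primrecPred.1 hp
  obtain ⟨q', hq', h'⟩ := iff_exists_primrecPred.1 hq
  refine iff_exists_primrecPred.2 ⟨fun a n => p' a n ∨ q' a n, hp'.or hq', fun a => ?_⟩
  rw [h, h', exists_or]

theorem exists_of {p : α → β → Prop} (hp : REPred fun c : α × β => p c.1 c.2) :
    REPred fun a => ∃ b, p a b := by
  classical
  obtain ⟨q, hq, h⟩ := iff_exists_primrecPred.1 hp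
  -- The witness is a pair of a code of `b` and a witness of `p a b`.
  let r : α → ℕ → Prop := fun a n =>
    ((Encodable.decode (α := β) n.unpair.1).elim false fun b => decide (q (a, b) n.unpair.2)) = true
  refine iff_exists_primrecPred.2 ⟨r, ?_, fun a => ?_⟩
  · have hu := Primrec.unpair.comp (Primrec.snd (α := α) (β := ℕ))
    refine Primrec.eq.comp ((Primrec.option_casesOn
      (Primrec.decode.comp (Primrec.fst.comp hu)) (Primrec.const false) (g := fun (c : α × ℕ) b =>
        decide (q (c.1, b) c.2.unpair.2)) ?_).of_eq fun c => ?_) (Primrec.const true)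
    · exact hq.decide.comp (((Primrec.fst.comp Primrec.fst).pair Primrec.snd).pair
        (Primrec.snd.comp (hu.comp Primrec.fst)))
    · cases (Encodable.decode (α := β) c.2.unpair.1) <;> rfl
  · have h' : ∀ b, p a b ↔ ∃ n, q (a, b) n := fun b => h (a, b)
    simp only [r, h']
    constructor
    · rintro ⟨b, n, hn⟩
      exact ⟨Nat.pair (Encodable.encode b) n, by simpa using hn⟩
    · rintro ⟨n, hn⟩
      cases hb : Encodable.decode (α := β) n.unpair.1 with
      | none => simp [hb] at hn
      | some b => exact ⟨b, n.unpair.2, by simpa [hb] using hn⟩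

theorem forall_lt {p : α → ℕ → Prop} (hp : REPred fun c : α × ℕ => p c.1 c.2) {f : α → ℕ}
    (hf : Primrec f) : REPred fun a => ∀ i < f a, p a i := by
  obtain ⟨q, hq, h⟩ := iff_exists_primrecPred.1 hp
  refine iff_exists_primrecPred.2 ⟨fun a N => ∀ i < f a, ∃ n < N, q (a, i) n, ?_, fun a => ?_⟩
  · refine PrimrecPred.forall_lt_comp (p := fun (b : α × ℕ) i => ∃ n < b.2, q (b.1, i) n) ?_
      (hf.comp Primrec.fst)
    refine PrimrecPred.exists_lt_comp (p := fun (b : (α × ℕ) × ℕ) n => q (b.1.1, b.2) n) ?_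
      (Primrec.snd.comp Primrec.fst)
    exact hq.comp (((Primrec.fst.comp (Primrec.fst.comp Primrec.fst)).pair
      (Primrec.snd.comp Primrec.fst)).pair Primrec.snd)
  · constructor
    · intro H
      choose! g hg using fun i (hi : i < f a) => (h (a, i)).1 (H i hi)
      refine ⟨(Finset.range (f a)).sup g + 1, fun i hi => ⟨g i, ?_, hg i hi⟩⟩
      exact Nat.lt_succ_of_le (Finset.le_sup (Finset.mem_range.2 hi))
    · rintro ⟨N, hN⟩ i hi
      obtain ⟨n, -, hn⟩ := hN i hi
      exact (h (a, i)).2 ⟨n, hn⟩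

end REPred

/-! ### Configurations with period `m ℤ^d` -/

section PeriodLattice

variable {A : Type*} {d : ℕ}

theorem mem_periodLattice {x : (Fin d → ℤ) → A} {v : Fin d → ℤ} :
    v ∈ periodLattice x ↔ ∀ z, x z = x (z + v) := Iff.rfl

end PeriodLattice

/-- The point of the box `[0, m)^d` whose coordinates are the base `m` digits of `i`. -/
def boxPoint (d m i : ℕ) : Fin d → ℤ := fun j => ((i / m ^ (j : ℕ) % m : ℕ) : ℤ)

/-- The index of the box point congruent to `z` modulo `m`: the number with base `m` digits
`z j mod m`. -/
def boxIndex {d : ℕ} (m : ℕ) (z : Fin d → ℤ) : ℕ := ∑ j, (z j % m).toNat * m ^ (j : ℕ)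

/-- The configuration with periods `m ℤ^d` whose restriction to the box `[0, m)^d` is given by the
base `k + 1` digits of `w`. -/
def boxConfig {d : ℕ} (k m w : ℕ) (z : Fin d → ℤ) : Fin (k + 1) :=
  Fin.ofNat (k + 1) (w / (k + 1) ^ boxIndex m z)

section Box

variable {d : ℕ}

theorem boxIndex_congr {m : ℕ} {z z' : Fin d → ℤ} (h : ∀ j, z j ≡ z' j [ZMOD m]) :
    boxIndex m z = boxIndex m z' := by
  simp only [boxIndex]
  exact Finset.sum_congr rfl fun j _ => by rw [h j]

theorem boxIndex_lt {m : ℕ} (hm : 0 < m) (z : Fin d → ℤ) : boxIndex m z < m ^ d := by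
  have h (j) : (z j % m).toNat < m := by
    have := Int.emod_lt_of_pos (z j) (b := m) (by omega)
    omega
  have := (finFunctionFinEquiv fun j => (⟨_, h j⟩ : Fin m)).2
  rwa [finFunctionFinEquiv_apply] at this

theorem boxPoint_boxIndex {m : ℕ} (hm : 0 < m) (z : Fin d → ℤ) :
    boxPoint d m (boxIndex m z) = fun j => z j % m := by
  have h (j) : (z j % m).toNat < m := by
    have := Int.emod_lt_of_pos (z j) (b := m) (by omega)
    omega
  have h' := finFunctionFinEquiv.symm_apply_apply fun j => (⟨_, h j⟩ : Fin m)
  funext j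
  have h'' := congrArg Fin.val (congrFun h' j)
  have e : boxIndex m z = (finFunctionFinEquiv fun j => (⟨_, h j⟩ : Fin m)).1 := by
    rw [finFunctionFinEquiv_apply]; rfl
  have : boxIndex m z / m ^ (j : ℕ) % m = (z j % m).toNat := by
    rw [e]; exact h''
  rw [boxPoint, this, Int.toNat_of_nonneg (Int.emod_nonneg _ (by omega))]

theorem boxPoint_modEq {m : ℕ} (hm : 0 < m) (z : Fin d → ℤ) (j : Fin d) :
    boxPoint d m (boxIndex m z) j ≡ z j [ZMOD m] := by
  rw [boxPoint_boxIndex hm]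
  exact Int.mod_modEq _ _

theorem boxPoint_boxIndex_of_mem {m : ℕ} {z : Fin d → ℤ} (hm : 0 < m)
    (hz : ∀ j, 0 ≤ z j ∧ z j < m) : boxPoint d m (boxIndex m z) = z := by
  rw [boxPoint_boxIndex hm]
  exact funext fun j => Int.emod_eq_of_lt (hz j).1 (hz j).2

theorem boxPoint_nonneg (m i : ℕ) (j : Fin d) : 0 ≤ boxPoint d m i j := Int.natCast_nonneg _

theorem boxPoint_lt {m : ℕ} (hm : 0 < m) (i : ℕ) (j : Fin d) : boxPoint d m i j < m := by
  simp only [boxPoint]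
  exact_mod_cast Nat.mod_lt _ hm

theorem boxConfig_congr {k m w : ℕ} {z z' : Fin d → ℤ} (h : ∀ j, z j ≡ z' j [ZMOD m]) :
    boxConfig k m w z = boxConfig k m w z' := by
  rw [boxConfig, boxConfig, boxIndex_congr h]

theorem smul_mem_periodLattice_boxConfig (k m w : ℕ) (u : Fin d → ℤ) :
    (m : ℤ) • u ∈ periodLattice (boxConfig (d := d) k m w) := fun z =>
  boxConfig_congr fun j => by simp [Int.ModEq]

/-- A configuration with periods `m ℤ^d` only depends on coordinates modulo `m`. -/
theorem congr_of_smul_mem_periodLattice {A : Type*} {x : (Fin d → ℤ) → A} {m : ℕ}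
    (hx : ∀ u, (m : ℤ) • u ∈ periodLattice x) {z z' : Fin d → ℤ}
    (h : ∀ j, z j ≡ z' j [ZMOD m]) : x z = x z' := by
  choose u hu using fun j => (h j).dvd
  rw [hx u z]
  congr 1
  funext j
  simp [← hu j]

theorem exists_eq_boxConfig {k m : ℕ} (hm : 0 < m) {x : (Fin d → ℤ) → Fin (k + 1)}
    (hx : ∀ u, (m : ℤ) • u ∈ periodLattice x) :
    ∃ w < (k + 1) ^ m ^ d, x = boxConfig k m w := by
  let f : Fin (m ^ d) → Fin (k + 1) := fun i => x (boxPoint d m i)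
  refine ⟨finFunctionFinEquiv f, (finFunctionFinEquiv f).2, funext fun z => ?_⟩
  have h := congrFun (finFunctionFinEquiv.symm_apply_apply f) ⟨boxIndex m z, boxIndex_lt hm z⟩
  have h₁ : f ⟨boxIndex m z, boxIndex_lt hm z⟩ = x z :=
    congr_of_smul_mem_periodLattice hx (boxPoint_modEq hm z)
  rw [← h₁, ← h]
  rfl

/-- A vector is a period of `boxConfig k m w`, tested on one box only. -/
def IsBoxPeriod (k m w : ℕ) (u : Fin d → ℤ) : Prop :=
  ∀ i < m ^ d, boxConfig k m w (boxPoint d m i) = boxConfig k m w (boxPoint d m i + u)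

theorem isBoxPeriod_iff {k m w : ℕ} (hm : 0 < m) {u : Fin d → ℤ} :
    IsBoxPeriod k m w u ↔ u ∈ periodLattice (boxConfig (d := d) k m w) := by
  refine ⟨fun h z => ?_, fun h i _ => h _⟩
  have h₁ := h (boxIndex m z) (boxIndex_lt hm z)
  rw [boxConfig_congr (boxPoint_modEq hm z)] at h₁
  rw [h₁]
  exact boxConfig_congr fun _ => (boxPoint_modEq hm z _).add_right _

/-- The lattice of periods of `boxConfig k m w` is generated by `m ℤ^d` and the vectors `v i`,
expressed with bounded quantifiers only. -/
def BoxPeriodsSpannedBy (k m w : ℕ) (v : Fin d → (Fin d → ℤ)) : Prop :=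
  (∀ i, IsBoxPeriod k m w (v i)) ∧
    ∀ i < m ^ d, IsBoxPeriod k m w (boxPoint d m i) →
      ∃ c < m ^ d, ∀ j, (m : ℤ) ∣ boxPoint d m i j - ∑ l, boxPoint d m c l * v l j

theorem boxPeriodsSpannedBy_iff {k m w : ℕ} (hm : 0 < m) {v : Fin d → (Fin d → ℤ)}
    (hv : ∀ u : Fin d → ℤ, (m : ℤ) • u ∈ Submodule.span ℤ (Set.range v)) :
    BoxPeriodsSpannedBy k m w v ↔
      periodLattice (boxConfig (d := d) k m w) = Submodule.span ℤ (Set.range v) := by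
  simp only [BoxPeriodsSpannedBy, isBoxPeriod_iff hm]
  have hbox (z : Fin d → ℤ) : ∃ u : Fin d → ℤ, z = boxPoint d m (boxIndex m z) + (m : ℤ) • u := by
    choose u hu using fun j => (boxPoint_modEq hm z j).dvd
    exact ⟨u, funext fun j => by simp [← hu j]⟩
  constructor
  · rintro ⟨h₁, h₂⟩
    refine le_antisymm (fun u hu => ?_) (Submodule.span_le.2 (Set.range_subset_iff.2 h₁))
    obtain ⟨u', hu'⟩ := hbox u
    obtain ⟨c, -, hc⟩ := h₂ (boxIndex m u) (boxIndex_lt hm u) (by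
      have := sub_mem hu (smul_mem_periodLattice_boxConfig k m w u')
      rwa [← eq_sub_of_add_eq hu'.symm] at this)
    choose e he using hc
    have : u = ∑ l, boxPoint d m c l • v l + (m : ℤ) • (e + u') := by
      funext j
      have h₃ := he j
      have h₄ := congrFun hu' j
      simp only [Pi.add_apply, Pi.smul_apply, smul_eq_mul, Finset.sum_apply] at h₄ ⊢
      linarith
    rw [this]
    exact add_mem (sum_mem fun l _ => Submodule.smul_mem _ _
      (Submodule.subset_span (Set.mem_range_self l))) (hv _)
  · intro h
    rw [h]
    refine ⟨fun i => Submodule.subset_span (Set.mem_range_self i), fun i _ hi => ?_⟩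
    obtain ⟨c, hc⟩ := (Submodule.mem_span_range_iff_exists_fun ℤ).1 hi
    refine ⟨boxIndex m c, boxIndex_lt hm c, fun j => ?_⟩
    have h₁ := congrFun hc j
    simp only [Finset.sum_apply, Pi.smul_apply, smul_eq_mul] at h₁
    rw [← h₁, ← Finset.sum_sub_distrib]
    refine Finset.dvd_sum fun l _ => ?_
    rw [← sub_mul]
    exact Dvd.dvd.mul_right (boxPoint_modEq hm c l).dvd _

end Box

section Primrec

variable {α : Type*} [Primcodable α] {d : ℕ}

theorem primrec_boxPoint {m i : α → ℕ} (hm : Primrec m) (hi : Primrec i) :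
    Primrec fun a => boxPoint d (m a) (i a) :=
  Primrec.fin_lambda fun j => Primrec.int_ofNat.comp (Primrec.nat_mod.comp
    (Primrec.nat_div.comp hi (Primrec.nat_pow_comp hm (Primrec.const (j : ℕ)))) hm)

theorem primrec_boxConfig {k : ℕ} {m w : α → ℕ} {z : α → Fin d → ℤ} (hm : Primrec m)
    (hw : Primrec w) (hz : Primrec z) : Primrec fun a => boxConfig k (m a) (w a) (z a) := by
  refine Primrec.fin_val_iff.1 (Primrec.nat_mod.comp (Primrec.nat_div.comp hw
    (Primrec.nat_pow_comp (Primrec.const _) ?_)) (Primrec.const _))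
  exact Primrec.fin_sum (fun hf hg => Primrec.nat_add.comp hf hg) fun j =>
    Primrec.nat_mul.comp (Primrec.int_toNat_emod (Primrec.fin_apply hz j) hm)
      (Primrec.nat_pow_comp hm (Primrec.const _))

theorem primrec_vec_add {f g : α → Fin d → ℤ} (hf : Primrec f) (hg : Primrec g) :
    Primrec fun a => f a + g a :=
  Primrec.fin_lambda fun j => Primrec.int_add (Primrec.fin_apply hf j) (Primrec.fin_apply hg j)

theorem primrec_linearCombination {n : ℕ} {c : α → Fin n → ℤ} {v : α → Fin n → (Fin d → ℤ)}
    (hc : Primrec c) (hv : Primrec v) : Primrec fun a => ∑ l, c a l • v a l := by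
  refine Primrec.fin_lambda fun j => ?_
  simp only [Finset.sum_apply, Pi.smul_apply, smul_eq_mul]
  exact Primrec.fin_sum Primrec.int_add fun l => Primrec.int_mul (Primrec.fin_apply hc l)
    (Primrec.fin_apply (Primrec.fin_apply hv l) j)

theorem primrecPred_isBoxPeriod {k : ℕ} {m w : α → ℕ} {u : α → Fin d → ℤ} (hm : Primrec m)
    (hw : Primrec w) (hu : Primrec u) :
    PrimrecPred fun a => IsBoxPeriod k (m a) (w a) (u a) := by
  refine PrimrecPred.forall_lt_comp (p := fun a i => boxConfig k (m a) (w a) (boxPoint d (m a) i) =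
    boxConfig k (m a) (w a) (boxPoint d (m a) i + u a)) ?_ (Primrec.nat_pow_comp hm (.const d))
  have hb := primrec_boxPoint (d := d) (hm.comp Primrec.fst) (Primrec.snd (α := α) (β := ℕ))
  exact Primrec.eq.comp (primrec_boxConfig (hm.comp Primrec.fst) (hw.comp Primrec.fst) hb)
    (primrec_boxConfig (hm.comp Primrec.fst) (hw.comp Primrec.fst)
      (primrec_vec_add hb (hu.comp Primrec.fst)))

theorem primrecPred_boxPeriodsSpannedBy {k : ℕ} {m w : α → ℕ} {v : α → Fin d → (Fin d → ℤ)}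
    (hm : Primrec m) (hw : Primrec w) (hv : Primrec v) :
    PrimrecPred fun a => BoxPeriodsSpannedBy k (m a) (w a) (v a) := by
  refine (PrimrecPred.forall_fin fun i =>
    primrecPred_isBoxPeriod hm hw (Primrec.fin_apply hv i)).and ?_
  have hmd := Primrec.nat_pow_comp hm (.const d)
  refine PrimrecPred.forall_lt_comp (p := fun a i =>
    IsBoxPeriod k (m a) (w a) (boxPoint d (m a) i) → ∃ c < m a ^ d, ∀ j,
      (m a : ℤ) ∣ boxPoint d (m a) i j - ∑ l, boxPoint d (m a) c l * v a l j)
    ?_ hmd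
  have hb := primrec_boxPoint (d := d) (hm.comp Primrec.fst) (Primrec.snd (α := α) (β := ℕ))
  refine (primrecPred_isBoxPeriod (hm.comp Primrec.fst) (hw.comp Primrec.fst) hb).imp ?_
  refine PrimrecPred.exists_lt_comp (p := fun (b : α × ℕ) c => ∀ j, (m b.1 : ℤ) ∣
    boxPoint d (m b.1) b.2 j - ∑ l, boxPoint d (m b.1) c l * v b.1 l j) ?_ (hmd.comp Primrec.fst)
  have hm' := hm.comp (Primrec.fst.comp (Primrec.fst (α := α × ℕ) (β := ℕ)))
  have hc := primrec_boxPoint (d := d) hm' Primrec.snd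
  refine PrimrecPred.forall_fin fun j => Primrec.int_natCast_dvd (Primrec.int_sub
    (Primrec.fin_apply (hb.comp Primrec.fst) j) (Primrec.fin_sum Primrec.int_add fun l =>
      Primrec.int_mul (Primrec.fin_apply hc l) (Primrec.fin_apply (Primrec.fin_apply
        (hv.comp (Primrec.fst.comp Primrec.fst)) l) j))) hm'

/-- Semidecided by a search for a matrix `C` with `C * v = m * 1`. -/
theorem rePred_smul_mem_span {m : α → ℕ} {v : α → Fin d → (Fin d → ℤ)} (hm : Primrec m)
    (hv : Primrec v) :
    REPred fun a => ∀ u : Fin d → ℤ, (m a : ℤ) • u ∈ Submodule.span ℤ (Set.range (v a)) := by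
  have h : REPred fun a => ∃ C : Fin d → (Fin d → ℤ), ∀ i,
      ∑ l, C i l • v a l = fun j => if i = j then (m a : ℤ) else 0 := by
    refine REPred.exists_of (REPred.of_primrecPred (PrimrecPred.forall_fin fun i =>
      Primrec.eq.comp (primrec_linearCombination (Primrec.fin_apply Primrec.snd i)
        (hv.comp Primrec.fst)) (Primrec.fin_lambda fun j => ?_)))
    split_ifs
    · exact Primrec.int_ofNat.comp (hm.comp Primrec.fst)
    · exact Primrec.const 0
  refine h.of_eq fun a => ⟨?_, fun H => ?_⟩
  · rintro ⟨C, hC⟩ u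
    have : (m a : ℤ) • u = ∑ i, u i • ∑ l, C i l • v a l := by
      simp only [hC]
      funext j
      simp [mul_comm]
    rw [this]
    exact sum_mem fun i _ => Submodule.smul_mem _ _ (sum_mem fun l _ =>
      Submodule.smul_mem _ _ (Submodule.subset_span (Set.mem_range_self l)))
  · choose C hC using fun i => (Submodule.mem_span_range_iff_exists_fun ℤ).1 (H (Pi.single i 1))
    refine ⟨C, fun i => (hC i).trans (funext fun j => ?_)⟩
    simp [Pi.single_apply, eq_comm]

theorem rePred_not_linearIndependent :
    REPred fun v : Fin d → (Fin d → ℤ) => ¬ LinearIndependent ℤ v := by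
  have h : REPred fun v : Fin d → (Fin d → ℤ) => ∃ c : Fin d → ℤ,
      ∑ l, c l • v l = 0 ∧ c ≠ 0 :=
    REPred.exists_of (REPred.of_primrecPred (.and (Primrec.eq.comp
      (primrec_linearCombination Primrec.snd Primrec.fst) (Primrec.const 0))
      (Primrec.eq.comp Primrec.snd (Primrec.const 0)).not))
  refine h.of_eq fun v => ?_
  rw [Fintype.not_linearIndependent_iff]
  simp [Function.ne_iff]

end Primrec

/-! ### Lattices of full rank -/

section FullRank

variable {d : ℕ}

theorem exists_smul_mem_of_finrank_eq {Γ : Submodule ℤ (Fin d → ℤ)}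
    (h : Module.finrank ℤ Γ = d) : ∃ m : ℕ, 0 < m ∧ ∀ u : Fin d → ℤ, (m : ℤ) • u ∈ Γ := by
  have : Finite ((Fin d → ℤ) ⧸ Γ) := Submodule.finiteQuotientOfFreeOfRankEq Γ (by simpa using h)
  refine ⟨Nat.card ((Fin d → ℤ) ⧸ Γ), Nat.card_pos, fun u => ?_⟩
  rw [← Submodule.Quotient.mk_eq_zero, Submodule.Quotient.mk_smul, natCast_zsmul]
  exact card_nsmul_eq_zero'

theorem exists_basis_of_finrank_eq {Γ : Submodule ℤ (Fin d → ℤ)} (h : Module.finrank ℤ Γ = d) :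
    ∃ v : Fin d → (Fin d → ℤ), LinearIndependent ℤ v ∧ Submodule.span ℤ (Set.range v) = Γ := by
  let b := Module.finBasisOfFinrankEq ℤ Γ h
  refine ⟨fun i => b i, b.linearIndependent.map' Γ.subtype Γ.ker_subtype, ?_⟩
  have := congrArg (Submodule.map Γ.subtype) b.span_eq
  rwa [Submodule.map_span, ← Set.range_comp, Submodule.map_top, Submodule.range_subtype] at this

theorem linearIndependent_of_finrank_span_eq {v : Fin d → (Fin d → ℤ)}
    (h : Module.finrank ℤ (Submodule.span ℤ (Set.range v)) = d) : LinearIndependent ℤ v :=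
  linearIndependent_iff_card_eq_finrank_span.2 (by simpa [Set.finrank] using h.symm)

end FullRank

open SymbolicDynamics.FullShift

/-! ### Forbidden patterns given by lists -/

section Codes

variable {A : Type*} [Inhabited A] {d : ℕ}

theorem exists_isCodeOfPattern (p : Pattern A (Fin d → ℤ)) : ∃ l, IsCodeOfPattern l p := by
  refine ⟨p.support.toList.map fun v => (v, p.config v), fun v a => ?_⟩
  simp only [List.mem_map, Finset.mem_toList, Prod.mk.injEq]
  constructor
  · rintro ⟨v, hv, rfl, rfl⟩
    exact ⟨hv, rfl⟩
  · rintro ⟨hv, h⟩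
    exact ⟨v, hv, rfl, h⟩

theorem IsCodeOfPattern.occursInAt_iff {l : List ((Fin d → ℤ) × A)} {p : Pattern A (Fin d → ℤ)}
    (h : IsCodeOfPattern l p) {x : (Fin d → ℤ) → A} {g : Fin d → ℤ} :
    p.occursInAt x g ↔ ∀ e ∈ l, x (g + e.1) = e.2 := by
  constructor
  · rintro H ⟨v, a⟩ he
    obtain ⟨hv, rfl⟩ := (h v a).1 he
    exact H v hv
  · intro H v hv
    exact H (v, p.config v) ((h v _).2 ⟨hv, rfl⟩)

theorem exists_isCodeOfPattern_iff {l : List ((Fin d → ℤ) × A)} :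
    (∃ p, IsCodeOfPattern l p) ↔ ∀ e ∈ l, ∀ e' ∈ l, e.1 = e'.1 → e.2 = e'.2 := by
  classical
  constructor
  · rintro ⟨p, hp⟩ ⟨v, a⟩ he ⟨v', a'⟩ he' (rfl : v = v')
    exact ((hp _ _).1 he).2.symm.trans ((hp _ _).1 he').2
  · intro H
    refine ⟨⟨fun v => if h : ∃ a, (v, a) ∈ l then h.choose else default,
      (l.map Prod.fst).toFinset, fun v hv => dif_neg fun h => hv ?_⟩, fun v a => ?_⟩
    · obtain ⟨a, ha⟩ := h
      exact List.mem_toFinset.2 (List.mem_map.2 ⟨_, ha, rfl⟩)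
    · simp only [List.mem_toFinset, List.mem_map, Prod.exists, exists_and_right, exists_eq_right]
      constructor
      · intro ha
        have h : ∃ a, (v, a) ∈ l := ⟨a, ha⟩
        exact ⟨h, by rw [dif_pos h]; exact H _ h.choose_spec _ ha rfl⟩
      · rintro ⟨h, rfl⟩
        rw [dif_pos h]
        exact h.choose_spec

/-- Forbidding the patterns listed by an r.e. predicate gives an effective subshift, provided
that the predicate only depends on the set of entries of a list. -/
theorem isEffectiveSubshift_of_rePred [Primcodable A] {Q : List ((Fin d → ℤ) × A) → Prop}
    (hQ : REPred Q) (hext : ∀ l l', (∀ e, e ∈ l ↔ e ∈ l') → Q l → Q l') :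
    IsEffectiveSubshift {x | ∀ g l, Q l → ∃ e ∈ l, x (g + e.1) ≠ e.2} := by
  classical
  refine ⟨{p | ∃ l, IsCodeOfPattern l p ∧ Q l}, ?_, ?_⟩
  · have hc : PrimrecPred fun l : List ((Fin d → ℤ) × A) =>
        ∀ e ∈ l, ∀ e' ∈ l, e.1 = e'.1 → e.2 = e'.2 := by
      refine PrimrecPred.forall_mem_list_comp (p := fun (l : List ((Fin d → ℤ) × A)) e =>
        ∀ e' ∈ l, e.1 = e'.1 → e.2 = e'.2) ?_ Primrec.id
      refine PrimrecPred.forall_mem_list_comp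
        (p := fun (b : List ((Fin d → ℤ) × A) × ((Fin d → ℤ) × A)) e' =>
          b.2.1 = e'.1 → b.2.2 = e'.2) ?_ Primrec.fst
      have h := Primrec.snd.comp (Primrec.fst (α := List ((Fin d → ℤ) × A) × ((Fin d → ℤ) × A))
        (β := (Fin d → ℤ) × A))
      exact (Primrec.eq.comp (Primrec.fst.comp h) (Primrec.fst.comp Primrec.snd)).imp
        (Primrec.eq.comp (Primrec.snd.comp h) (Primrec.snd.comp Primrec.snd))
    refine ((REPred.of_primrecPred hc).and hQ).of_eq fun l => ?_
    rw [← exists_isCodeOfPattern_iff]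
    constructor
    · rintro ⟨⟨p, hp⟩, h⟩
      exact ⟨p, ⟨l, hp, h⟩, hp⟩
    · rintro ⟨p, ⟨l', hp', h⟩, hp⟩
      exact ⟨⟨p, hp⟩, hext l' l (fun e => (hp' e.1 e.2).trans (hp e.1 e.2).symm) h⟩
  · ext x
    constructor
    · rintro H p ⟨l, hp, h⟩ g hg
      obtain ⟨e, he, hne⟩ := H g l h
      exact hne (hp.occursInAt_iff.1 hg e he)
    · intro H g l h
      by_contra! hne
      obtain ⟨p, hp⟩ := exists_isCodeOfPattern_iff.2 fun e he e' he' hee =>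
        (hne e he).symm.trans ((congrArg (fun v => x (g + v)) hee).trans (hne e' he'))
      exact H p ⟨l, hp, h⟩ g (hp.occursInAt_iff.2 hne)

theorem notMem_forbidden_iff {F : Set (Pattern A (Fin d → ℤ))} {x : (Fin d → ℤ) → A} :
    x ∉ forbidden F ↔ ∃ l : List ((Fin d → ℤ) × A), ∃ g : Fin d → ℤ,
      (∃ p ∈ F, IsCodeOfPattern l p) ∧ ∀ e ∈ l, x (g + e.1) = e.2 := by
  constructor
  · intro h
    simp only [forbidden, Set.mem_ofPred_eq, not_forall, not_not] at h
    obtain ⟨p, hp, g, hg⟩ := h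
    obtain ⟨l, hl⟩ := exists_isCodeOfPattern p
    exact ⟨l, g, ⟨p, hp, hl⟩, hl.occursInAt_iff.1 hg⟩
  · rintro ⟨l, g, ⟨p, hp, hl⟩, hg⟩ h
    exact h p hp g (hl.occursInAt_iff.2 hg)

end Codes

/-! ### Periods of an effective subshift -/

section EffectiveToCoRE

variable {d k : ℕ}

theorem rePred_boxConfig_notMem_forbidden {F : Set (Pattern (Fin (k + 1)) (Fin d → ℤ))}
    (hF : IsREPatternSet F) {α : Type*} [Primcodable α] {m w : α → ℕ} (hm : Primrec m)
    (hw : Primrec w) : REPred fun a => boxConfig k (m a) (w a) ∉ forbidden F := by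
  let P := (α × List ((Fin d → ℤ) × Fin (k + 1))) × (Fin d → ℤ)
  have ha : Primrec fun c : P => c.1.1 := Primrec.fst.comp Primrec.fst
  have hl : Primrec fun c : P => c.1.2 := Primrec.snd.comp Primrec.fst
  have hg : Primrec fun c : P => c.2 := Primrec.snd
  have h₁ : REPred fun c : P => ∃ p ∈ F, IsCodeOfPattern c.1.2 p :=
    REPred.comp (p := fun l => ∃ p ∈ F, IsCodeOfPattern l p) hF hl
  have h₂ : PrimrecPred fun c : P =>
      ∀ e ∈ c.1.2, boxConfig k (m c.1.1) (w c.1.1) (c.2 + e.1) = e.2 := by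
    refine PrimrecPred.forall_mem_list_comp (p := fun (c : P) (e : (Fin d → ℤ) × Fin (k + 1)) =>
      boxConfig k (m c.1.1) (w c.1.1) (c.2 + e.1) = e.2) ?_ hl
    exact Primrec.eq.comp (primrec_boxConfig (hm.comp (ha.comp Primrec.fst))
      (hw.comp (ha.comp Primrec.fst)) (primrec_vec_add (hg.comp Primrec.fst)
        (Primrec.fst.comp Primrec.snd))) (Primrec.snd.comp Primrec.snd)
  have h := REPred.exists_of (p := fun a l => ∃ g : Fin d → ℤ, (∃ p ∈ F, IsCodeOfPattern l p) ∧
    ∀ e ∈ l, boxConfig k (m a) (w a) (g + e.1) = e.2) (REPred.exists_of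
    (p := fun (b : α × List ((Fin d → ℤ) × Fin (k + 1))) (g : Fin d → ℤ) =>
      (∃ p ∈ F, IsCodeOfPattern b.2 p) ∧
        ∀ e ∈ b.2, boxConfig k (m b.1) (w b.1) (g + e.1) = e.2)
    (h₁.and (REPred.of_primrecPred h₂)))
  exact h.of_eq fun a => notMem_forbidden_iff.symm

/-- A lattice `L ⊇ m ℤ^d` is not a lattice of periods of the subshift if and only if each of the
finitely many configurations with periods `m ℤ^d` has other periods or contains a forbidden
pattern. -/
theorem isCoRELatticeSet_fullRankPeriodLattices {X : Set ((Fin d → ℤ) → Fin (k + 1))}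
    (hX : IsEffectiveSubshift X) : IsCoRELatticeSet (fullRankPeriodLattices X) := by
  obtain ⟨F, hF, rfl⟩ := hX
  have h : REPred fun v : Fin d → (Fin d → ℤ) => ∃ m : ℕ, 0 < m ∧
      (∀ u : Fin d → ℤ, (m : ℤ) • u ∈ Submodule.span ℤ (Set.range v)) ∧
      ∀ w < (k + 1) ^ m ^ d,
        ¬ BoxPeriodsSpannedBy k m w v ∨ boxConfig k m w ∉ forbidden F := by
    have hm := Primrec.snd (α := Fin d → (Fin d → ℤ)) (β := ℕ)
    refine REPred.exists_of (REPred.and (REPred.of_primrecPred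
      (Primrec.nat_lt.comp (Primrec.const 0) hm)) ((rePred_smul_mem_span hm Primrec.fst).and ?_))
    refine REPred.forall_lt (p := fun (b : (Fin d → (Fin d → ℤ)) × ℕ) w =>
      ¬ BoxPeriodsSpannedBy k b.2 w b.1 ∨ boxConfig k b.2 w ∉ forbidden F) ?_
      (Primrec.nat_pow_comp (Primrec.const _) (Primrec.nat_pow_comp hm (Primrec.const _)))
    have hm' := hm.comp (Primrec.fst (α := (Fin d → (Fin d → ℤ)) × ℕ) (β := ℕ))
    exact (REPred.of_primrecPred (primrecPred_boxPeriodsSpannedBy hm' Primrec.snd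
      (Primrec.fst.comp Primrec.fst)).not).or (rePred_boxConfig_notMem_forbidden hF hm' Primrec.snd)
  refine (rePred_not_linearIndependent.or h).of_eq fun v => ?_
  rw [not_and_or]
  by_cases hv : LinearIndependent ℤ v
  swap
  · simp [hv]
  have hr : Module.finrank ℤ (Submodule.span ℤ (Set.range v)) = d := by
    rw [finrank_span_eq_card hv, Fintype.card_fin]
  simp only [hv, not_true_eq_false, false_or]
  constructor
  · rintro ⟨m, hm, hmv, H⟩ ⟨-, x, hx, hxv⟩
    obtain ⟨w, hw, rfl⟩ := exists_eq_boxConfig hm (x := x) (by rwa [hxv])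
    exact (H w hw).elim (fun h => h ((boxPeriodsSpannedBy_iff hm hmv).2 hxv)) fun h => h hx
  · intro H
    obtain ⟨m, hm, hmv⟩ := exists_smul_mem_of_finrank_eq hr
    refine ⟨m, hm, hmv, fun w _ => ?_⟩
    rw [boxPeriodsSpannedBy_iff hm hmv, ← not_and_or]
    exact fun h => H ⟨hr, _, h.2, h.1⟩

end EffectiveToCoRE

/-! ### Periodic configurations without shorter local periods -/

/-- The letter at position `n` of the periodic word with period `a` in which the multiples of `a`
carry the letter `2`, and a position `r` with `0 < r < a`, up to multiples of `a`, carries the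
parity of the `2`-adic valuation of `r`. -/
def markedRulerWord (a : ℕ) (n : ℤ) : Fin 3 :=
  if n % a = 0 then 2 else if Even (padicValInt 2 (n % a)) then 0 else 1

theorem markedRulerWord_eq_two_iff {a : ℕ} {n : ℤ} :
    markedRulerWord a n = 2 ↔ (a : ℤ) ∣ n := by
  rw [Int.dvd_iff_emod_eq_zero, markedRulerWord]
  split_ifs <;> simp_all

theorem markedRulerWord_congr {a : ℕ} {n n' : ℤ} (h : n ≡ n' [ZMOD a]) :
    markedRulerWord a n = markedRulerWord a n' := by
  rw [markedRulerWord, markedRulerWord, h]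

theorem padicValInt_two_pow_mul_odd (e : ℕ) {b : ℤ} (hb : Odd b) :
    padicValInt 2 (2 ^ e * b) = e := by
  have hb0 : b ≠ 0 := by rintro rfl; simp at hb
  rw [padicValInt.mul (by positivity) hb0, padicValInt.eq_zero_of_not_dvd (z := b)
    (by exact_mod_cast fun h => Int.not_even_iff_odd.2 hb (even_iff_two_dvd.2 h))]
  simp [padicValInt, Int.natAbs_pow]

/-- For `m = 2 ^ e * b` with `b` odd, the parities of the `2`-adic valuations of `n` and `n + m`
differ when `n + m` is an odd multiple of `2 ^ (e + 1)`, which recurs with period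
`2 ^ (e + 2) ≤ 4 * m`. -/
theorem exists_even_padicValInt_ne {m : ℕ} (hm : 0 < m) (r : ℤ) :
    ∃ n : ℕ, n < 4 * m ∧
      ¬ (Even (padicValInt 2 (r + n)) ↔ Even (padicValInt 2 (r + n + m))) := by
  obtain ⟨e, b, hb, rfl⟩ := Nat.exists_eq_two_pow_mul_odd hm.ne'
  -- Choose `n` with `r + n + m = 2 ^ (e + 1) * c`, `c` odd; then `r + n` has valuation `e`.
  have hpos : (0 : ℤ) < 2 ^ (e + 2) := by positivity
  have h₁ := Int.emod_nonneg (2 ^ (e + 1) - 2 ^ e * b - r) hpos.ne'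
  have h₂ := Int.emod_lt_of_pos (2 ^ (e + 1) - 2 ^ e * b - r) hpos
  have h₃ := Int.emod_add_mul_ediv (2 ^ (e + 1) - 2 ^ e * b - r) (2 ^ (e + 2))
  set q := (2 ^ (e + 1) - 2 ^ e * b - r) / (2 : ℤ) ^ (e + 2)
  obtain ⟨n, hn⟩ := Int.eq_ofNat_of_zero_le h₁
  rw [hn] at h₂ h₃
  have hb' : Odd (b : ℤ) := by exact_mod_cast hb
  refine ⟨n, ?_, ?_⟩
  · have hb1 : 1 ≤ b := hb.pos
    have : (2 : ℤ) ^ (e + 2) ≤ 4 * (2 ^ e * b) := by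
      rw [pow_add]
      have : (2 : ℤ) ^ e * 1 ≤ 2 ^ e * b := by gcongr; exact_mod_cast hb1
      linarith
    exact_mod_cast h₂.trans_le this
  · have e₁ : r + n + (2 ^ e * b : ℕ) = 2 ^ (e + 1) * (1 - 2 * q) := by
      push_cast
      rw [pow_succ] at h₃ ⊢
      rw [pow_succ] at h₃
      linarith
    have e₂ : r + n = 2 ^ e * (2 * (1 - 2 * q) - b) := by
      rw [pow_add] at e₁
      push_cast at e₁
      linarith
    rw [e₁, padicValInt_two_pow_mul_odd _ ⟨-q, by ring⟩, e₂,
      padicValInt_two_pow_mul_odd _ ((even_two_mul _).sub_odd hb'), Nat.even_add_one]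
    tauto

/-- If a marked ruler word has period `m` on an interval of length `8 * m`, then that period is
global: a marked position in the interval makes `m` a multiple of `a`, and without one the interval
lies in the ruler sequence. -/
theorem dvd_of_markedRulerWord_eq {a m : ℕ} (ha : 0 < a) (hm : 0 < m) {s : ℤ}
    (h : ∀ n : ℕ, n < 7 * m → markedRulerWord a (s + n) = markedRulerWord a (s + n + m)) :
    a ∣ m := by
  by_contra hdvd
  have hfree (n : ℕ) (hn : n < 6 * m) : ¬ (a : ℤ) ∣ s + n := fun hd => by
    have h₁ := h n (by omega)
    rw [markedRulerWord_eq_two_iff.2 hd, eq_comm, markedRulerWord_eq_two_iff] at h₁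
    exact hdvd (by exact_mod_cast (Int.dvd_add_right hd).1 h₁)
  have ha' : (0 : ℤ) < a := by exact_mod_cast ha
  have hr₀ := Int.emod_nonneg s ha'.ne'
  have hr₁ := Int.emod_lt_of_pos s ha'
  have hrs := Int.emod_add_mul_ediv s a
  have hlt : s % a + 6 * m ≤ a := by
    by_contra! hlt
    refine hfree (a - s % a).toNat (by omega) ?_
    rw [Int.toNat_of_nonneg (by omega)]
    exact ⟨s / a + 1, by linarith⟩
  have hpos : 0 < s % a := by
    refine lt_of_le_of_ne hr₀ fun h0 => hfree 0 (by omega) ?_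
    simpa using Int.dvd_of_emod_eq_zero h0.symm
  obtain ⟨n, hn, hne⟩ := exists_even_padicValInt_ne hm (s % a)
  have hmod (t : ℕ) (ht : t < 5 * m) : (s + t) % a = s % a + t := by
    rw [← Int.emod_add_emod, Int.emod_eq_of_lt (by omega) (by omega)]
  have h₁ := h n (by omega)
  have e₂ : (s + n + m) % a = s % a + n + m := by
    have := hmod (n + m) (by omega)
    push_cast at this
    rw [add_assoc, this, add_assoc]
  have n₁ : s % a + n ≠ 0 := by omega
  have n₂ : s % a + n + m ≠ 0 := by omega
  rw [markedRulerWord, markedRulerWord, hmod n (by omega), e₂, if_neg n₁, if_neg n₂] at h₁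
  refine hne ⟨fun h => ?_, fun h => ?_⟩
  · by_contra h'
    simp [h, h'] at h₁
  · by_contra h'
    simp [h, h'] at h₁

/-- Positions along the orbits of translation by `g`, counted from a base point of each orbit. -/
theorem exists_orbit_position {T : Type*} [AddCommGroup T] (g : T) :
    ∃ pos : T → ℤ, ∀ t (n : ℤ), pos (t + n • g) ≡ pos t + n [ZMOD addOrderOf g] := by
  have h (t : T) : ∃ n : ℤ,
      n • g = t - (QuotientAddGroup.mk (s := AddSubgroup.zmultiples g) t).out := by
    refine AddSubgroup.mem_zmultiples_iff.1 ?_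
    rw [← QuotientAddGroup.eq_iff_sub_mem]
    exact (Quotient.out_eq' _).symm
  choose pos hpos using h
  refine ⟨pos, fun t n => zsmul_eq_zsmul_iff_modEq.1 ?_⟩
  have : (QuotientAddGroup.mk (t + n • g) : T ⧸ AddSubgroup.zmultiples g) =
      QuotientAddGroup.mk t := by
    rw [QuotientAddGroup.eq_iff_sub_mem]
    simp
  rw [hpos, this, add_zsmul, hpos]
  abel

/-- Over one alphabet, each lattice `L` of full rank is the lattice of periods of a configuration
for which periods `m` in all coordinate directions on the sides of one box of side `8 * m` force
`m ℤ^d ⊆ L`. One track per coordinate direction carries marked ruler words on the lines of that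
direction, and one more track marks `L` itself. -/
theorem exists_locally_aperiodic_config (d : ℕ) :
    ∃ k : ℕ, ∀ L : Submodule ℤ (Fin d → ℤ), Module.finrank ℤ L = d →
      ∃ x : (Fin d → ℤ) → Fin (k + 1), periodLattice x = L ∧ ∀ m : ℕ, 0 < m → ∀ g : Fin d → ℤ,
        (∀ i, ∀ n : ℕ, n < 7 * m →
          x (g + Pi.single i (n : ℤ)) = x (g + Pi.single i ((n : ℤ) + m))) →
        ∀ u : Fin d → ℤ, (m : ℤ) • u ∈ L := by
  classical
  obtain ⟨k, hk⟩ := Nat.exists_eq_succ_of_ne_zero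
    (Fintype.card_ne_zero (α := (Fin d → Fin 3) × Bool))
  let φ : (Fin d → Fin 3) × Bool ≃ Fin (k + 1) := Fintype.equivFinOfCardEq hk
  refine ⟨k, fun L hL => ?_⟩
  have : Finite ((Fin d → ℤ) ⧸ L) := (Submodule.finiteQuotient_iff L).2 (by simpa using hL)
  let e (i : Fin d) : (Fin d → ℤ) ⧸ L := L.mkQ (Pi.single i 1)
  choose pos hpos using fun i => exists_orbit_position (e i)
  have he (i : Fin d) (n : ℤ) : L.mkQ (Pi.single i n) = n • e i := by
    rw [← map_zsmul, ← Pi.single_smul, smul_eq_mul, mul_one]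
  let x (z : Fin d → ℤ) : Fin (k + 1) :=
    φ (fun i => markedRulerWord (addOrderOf (e i)) (pos i (L.mkQ z)), decide (z ∈ L))
  refine ⟨x, le_antisymm (fun v hv => ?_) fun v hv z => ?_, fun m hm g h u => ?_⟩
  · have := congrArg Prod.snd (φ.injective (hv 0))
    simpa using this
  · have h₁ : L.mkQ (z + v) = L.mkQ z := by simp [(Submodule.Quotient.mk_eq_zero L).2 hv]
    have h₂ : z + v ∈ L ↔ z ∈ L := Submodule.add_mem_iff_left L hv
    simp only [x, h₁, h₂]
  · have hdvd (i : Fin d) : addOrderOf (e i) ∣ m := by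
      refine dvd_of_markedRulerWord_eq (addOrderOf_pos (e i)) hm (s := pos i (L.mkQ g))
        fun n hn => ?_
      have h₁ := congrFun (congrArg Prod.fst (φ.injective (h i n hn))) i
      simp only [map_add, he] at h₁
      rw [markedRulerWord_congr (hpos i _ _), markedRulerWord_congr (hpos i _ _),
        ← add_assoc] at h₁
      exact h₁
    have hu : (m : ℤ) • u = ∑ i, u i • Pi.single i (m : ℤ) := by
      funext j
      simp [Pi.single_apply, mul_comm]
    rw [hu]
    refine sum_mem fun i _ => L.smul_mem _ ?_
    rw [← Submodule.Quotient.mk_eq_zero, ← Submodule.mkQ_apply, he, natCast_zsmul]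
    exact addOrderOf_dvd_iff_nsmul_eq_zero.1 (hdvd i)

/-! ### A subshift with prescribed periods -/

/-- For a co-r.e. set `S`, forbid each pattern that agrees on the box `[0, 8 * m)^d` with a
configuration with periods `m ℤ^d` whose lattice of periods is not in `S`. -/
theorem exists_effectiveSubshift_of_isCoRELatticeSet {d : ℕ} {S : Set (Submodule ℤ (Fin d → ℤ))}
    (hS : ∀ Γ ∈ S, Module.finrank ℤ Γ = d) (hco : IsCoRELatticeSet S) :
    ∃ (k : ℕ) (X : Set ((Fin d → ℤ) → Fin (k + 1))),
      IsEffectiveSubshift X ∧ fullRankPeriodLattices X = S := by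
  obtain ⟨k, hk⟩ := exists_locally_aperiodic_config d
  let R (m w : ℕ) (v : Fin d → (Fin d → ℤ)) : Prop :=
    ¬ (LinearIndependent ℤ v ∧ Submodule.span ℤ (Set.range v) ∈ S) ∧ 0 < m ∧
      (∀ u : Fin d → ℤ, (m : ℤ) • u ∈ Submodule.span ℤ (Set.range v)) ∧
      BoxPeriodsSpannedBy k m w v
  let B (m w : ℕ) (l : List ((Fin d → ℤ) × Fin (k + 1))) : Prop := ∀ i < (8 * m) ^ d,
    (boxPoint d (8 * m) i, boxConfig k m w (boxPoint d (8 * m) i)) ∈ l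
  let Q (l : List ((Fin d → ℤ) × Fin (k + 1))) : Prop := ∃ m w v, B m w l ∧ R m w v
  have hQ : REPred Q := by
    let P := ((List ((Fin d → ℤ) × Fin (k + 1)) × ℕ) × ℕ) × (Fin d → (Fin d → ℤ))
    have hv : Primrec fun a : P => a.2 := Primrec.snd
    have hw : Primrec fun a : P => a.1.2 := Primrec.snd.comp Primrec.fst
    have hm : Primrec fun a : P => a.1.1.2 := Primrec.snd.comp (Primrec.fst.comp Primrec.fst)
    have hl : Primrec fun a : P => a.1.1.1 := Primrec.fst.comp (Primrec.fst.comp Primrec.fst)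
    have h₁ : REPred fun a : P => R a.1.1.2 a.1.2 a.2 :=
      REPred.and (REPred.comp hco hv) (REPred.and
        (REPred.of_primrecPred (Primrec.nat_lt.comp (Primrec.const 0) hm))
        ((rePred_smul_mem_span hm hv).and
          (REPred.of_primrecPred (primrecPred_boxPeriodsSpannedBy hm hw hv))))
    have h₂ : PrimrecPred fun a : P => B a.1.1.2 a.1.2 a.1.1.1 := by
      have h8 := Primrec.nat_mul.comp (Primrec.const 8) hm
      refine PrimrecPred.forall_lt_comp (p := fun (a : P) i => (boxPoint d (8 * a.1.1.2) i,
        boxConfig k a.1.1.2 a.1.2 (boxPoint d (8 * a.1.1.2) i)) ∈ a.1.1.1) ?_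
        (Primrec.nat_pow_comp h8 (Primrec.const d))
      have hb := primrec_boxPoint (d := d) (h8.comp Primrec.fst) (Primrec.snd (α := P) (β := ℕ))
      exact PrimrecPred.mem_list (hb.pair (primrec_boxConfig (hm.comp Primrec.fst)
        (hw.comp Primrec.fst) hb)) (hl.comp Primrec.fst)
    exact REPred.exists_of (p := fun l m => ∃ w v, B m w l ∧ R m w v) (REPred.exists_of
      (p := fun (b : List ((Fin d → ℤ) × Fin (k + 1)) × ℕ) w => ∃ v, B b.2 w b.1 ∧ R b.2 w v)
      (REPred.exists_of (p := fun (c : (List ((Fin d → ℤ) × Fin (k + 1)) × ℕ) × ℕ) v =>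
        B c.1.2 c.2 c.1.1 ∧ R c.1.2 c.2 v) ((REPred.of_primrecPred h₂).and h₁)))
  have hext (l l' : List ((Fin d → ℤ) × Fin (k + 1))) (h : ∀ e, e ∈ l ↔ e ∈ l') :
      Q l → Q l' := fun ⟨m, w, v, hB, hR⟩ => ⟨m, w, v, fun i hi => (h _).1 (hB i hi), hR⟩
  refine ⟨k, _, isEffectiveSubshift_of_rePred hQ hext, Set.Subset.antisymm ?_ fun L hL => ?_⟩
  · rintro Γ ⟨hr, x, hx, rfl⟩
    by_contra hΓ
    obtain ⟨m, hm, hmΓ⟩ := exists_smul_mem_of_finrank_eq hr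
    obtain ⟨w, -, rfl⟩ := exists_eq_boxConfig hm hmΓ
    obtain ⟨v, hv, hvΓ⟩ := exists_basis_of_finrank_eq hr
    -- The list of the entries of the whole box is forbidden, but occurs at the origin.
    obtain ⟨e, he, hne⟩ := hx 0 ((List.range ((8 * m) ^ d)).map fun i =>
        (boxPoint d (8 * m) i, boxConfig k m w (boxPoint d (8 * m) i)))
      ⟨m, w, v, fun i hi => List.mem_map.2 ⟨i, List.mem_range.2 hi, rfl⟩,
        fun h => hΓ (hvΓ ▸ h.2), hm, by rwa [hvΓ],
        (boxPeriodsSpannedBy_iff hm (by rwa [hvΓ])).2 hvΓ.symm⟩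
    obtain ⟨i, -, rfl⟩ := List.mem_map.1 he
    exact hne (by rw [zero_add])
  · obtain ⟨x, hxL, hx⟩ := hk L (hS L hL)
    refine ⟨hS L hL, x, fun g l ⟨m, w, v, hB, hR, hm, hmv, hE⟩ => ?_, hxL⟩
    by_contra! hocc
    have hbox (z : Fin d → ℤ) (hz : ∀ j, 0 ≤ z j ∧ z j < (8 * m : ℕ)) :
        x (g + z) = boxConfig k m w z := by
      have hm8 : 0 < 8 * m := by omega
      have := hocc _ (hB (boxIndex (8 * m) z) (boxIndex_lt hm8 z))
      rwa [boxPoint_boxIndex_of_mem hm8 hz] at this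
    have hmL : ∀ u : Fin d → ℤ, (m : ℤ) • u ∈ L := by
      refine hx m hm g fun i n hn => ?_
      rw [hbox _ fun j => ?_, hbox _ fun j => ?_]
      · refine boxConfig_congr fun j => ?_
        rcases eq_or_ne j i with rfl | hj
        · simp [Int.ModEq]
        · simp [hj]
      · rcases eq_or_ne j i with rfl | hj
        · simp; omega
        · simp [hj]; omega
      · rcases eq_or_ne j i with rfl | hj
        · simp; omega
        · simp [hj]; omega
    -- Both configurations have periods `m ℤ^d`, so that they agree everywhere.
    have hall (z : Fin d → ℤ) : x (g + z) = boxConfig k m w z := by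
      have hz := boxPoint_modEq hm z
      rw [← boxConfig_congr hz, ← hbox _ fun j => ⟨boxPoint_nonneg _ _ _, ?_⟩]
      · exact congr_of_smul_mem_periodLattice (by rwa [hxL]) fun j => ((hz j).add_left _).symm
      · have := boxPoint_lt hm (boxIndex m z) j
        push_cast
        omega
    have hΓ : periodLattice (boxConfig k m w) = L := by
      rw [← hxL]
      ext v
      simp only [mem_periodLattice, ← hall]
      refine ⟨fun h z => ?_, fun h z => by rw [← add_assoc]; exact h _⟩
      have := h (z - g)
      rwa [← add_assoc, add_sub_cancel] at this
    rw [boxPeriodsSpannedBy_iff hm hmv, hΓ] at hE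
    refine hR ⟨linearIndependent_of_finrank_span_eq ?_, hE ▸ hL⟩
    rw [← hE, hS L hL]

theorem mainTheorem6 (d : ℕ) (hd : 0 < d) (S : Set (Submodule ℤ (Fin d → ℤ))) :
    (∃ (k : ℕ) (X : Set ((Fin d → ℤ) → Fin (k + 1))),
        IsEffectiveSubshift X ∧ fullRankPeriodLattices X = S) ↔
      (∀ Γ ∈ S, Module.finrank ℤ Γ = d) ∧ IsCoRELatticeSet S := by
  constructor
  · rintro ⟨k, X, hX, rfl⟩
    exact ⟨fun Γ hΓ => hΓ.1, isCoRELatticeSet_fullRankPeriodLattices hX⟩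
  · rintro ⟨hS, hco⟩
    exact exists_effectiveSubshift_of_isCoRELatticeSet hS hco
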